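/- Let $k$ be a field and $q\in k^{\times}$. Let $G$ be a group with a representation on a finite dimensional $k$-vector space $V$, written $v\mapsto {}^g v$ and extended to the symmetric algebra $S(V)$ by algebra automorphisms, and let $f\colon G\times G\to k^{\times}$ be a normal $2$-cocycle. Let $A=S(V)\#_f G$ be the crossed product, i.e. the $k$-algebra that is a free left $S(V)$-module with basis $\{w_g: g\in G\}$ and has product $(Pw_g)(Qw_h)=P\,{}^gQ\,f(g,h)w_{gh}$; here $P\in S(V)$ is identified with $Pw_1$. Let $\hat\alpha\colon V\to V$ be a bijective $k[G]$-linear map, $\chi_\alpha\colon G\to k^\times$ a group homomorphism, and $\alpha\colon A\to A$ the automorphism $\alpha(v_1\cdots v_m w_g)=\hat\alpha(v_1)\cdots\hat\alpha(v_m)\chi_\alpha(g)w_g$. For a subspace $U$ of $S(V)$ (for instance of $V$) that is spanned by a subspace of $V$ and at most one power $x^l$ of a vector outside that subspace, $S(U)$ is identified with the subalgebra of $S(V)$ generated by $U$. Assume: a) $V_1\neq V_2$ are subspaces of codimension $1$ of $V$ that are $\hat\alpha$-stable $G$-submodules; b) $g_1,g_2$ are central elements of $G$ with ${}^{g_1^{-1}}v={}^{g_2}v$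 for all $v\in V_1\cap V_2$; c) $\chi_\varsigma\colon G\to k^\times$ is a group homomorphism and $\hat\varsigma\colon V\to V$ is the linear map with $\hat\varsigma(v)=\hat\alpha({}^{g_1^{-1}}v)$ for $v\in V_1$ and $\hat\varsigma(v)=\hat\alpha({}^{g_2}v)$ for $v\in V_2$; d) $x_1\in V_2\setminus V_1$, $x_2\in V_1\setminus V_2$, $P_1\in S(V_1)$, $P_2\in S(V_2)$, and $\hat\delta_1,\hat\delta_2\colon V\to A$ are the linear maps with $\ker\hat\delta_i=V_i$ and $\hat\delta_i(x_i)=P_iw_{g_i}$ (so that $P_1,P_2\neq 0$). Let $\varsigma\colon A\to A$ be the linear map $\varsigma(v_1\cdots v_mw_g)=\hat\varsigma(v_1)\cdots\hat\varsigma(v_m)\chi_\varsigma(g)w_g$, and for $g\in G$ and $i\in\{1,2\}$ let $\lambda_{ig}\in k$ be the scalar with ${}^gx_i-\lambda_{ig}x_i\in V_i$. Assume that $$\lambda_{1g_1}\lambda_{1g_2}=q,\qquad \lambda_{2g_1}\lambda_{2g_2}=q^{-1},\qquad {}^{g_i}x_j=\lambda_{jg_i}x_j\quad\text{for } 1\le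 i,j\le 2.$$ Then there are unique $k$-linear maps $\delta_1,\delta_2\colon A\to A$ such that, for all $m\ge 0$, $v_1,\dots,v_m\in V$ and $g\in G$, $$\delta_1(v_1\cdots v_mw_g)=\sum_{j=1}^m\alpha(v_1\cdots v_{j-1})\,\hat\delta_1(v_j)\,\varsigma(v_{j+1}\cdots v_mw_g),$$ $$\delta_2(v_1\cdots v_mw_g)=\sum_{j=1}^m\varsigma\bigl(\alpha^{-1}(v_1\cdots v_{j-1})\bigr)\,\hat\delta_2(v_j)\,v_{j+1}\cdots v_mw_g,$$ and the following hold. (1) If $q\neq 1$, $l\ge 1$ and $q^l=1$, then $\delta_1^l=\delta_2^l=0$. (2) If $q$ is not a root of unity, or if $q=1$ and $k$ has characteristic $0$, then ($P_1\in\ker\delta_2$ and $P_2\in\ker\delta_1$) if and only if $P_1,P_2\in S(V_1\cap V_2)$. (3) If $q$ is a primitive $l$-th root of unity with $l\ge 2$, then ($P_1\in\ker\delta_2$ and $P_2\in\ker\delta_1$) if and only if $P_1\in S\bigl(kx_2^l\oplus(V_1\cap V_2)\bigr)$ and $P_2\in S\bigl(kx_1^l\oplus(V_1\cap V_2)\bigr)$.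 (4) If $q=1$ and $k$ has characteristic $p>0$, then ($P_1\in\ker\delta_2$ and $P_2\in\ker\delta_1$) if and only if $P_1\in S\bigl(kx_2^p\oplus(V_1\cap V_2)\bigr)$ and $P_2\in S\bigl(kx_1^p\oplus(V_1\cap V_2)\bigr)$. -/

import Mathlib

noncomputable section

namespace BraidedDeformation

/-- The algebra endomorphism of the symmetric algebra `S(V)` that extends the linear map `φ`. -/
def symMap {k V : Type*} [Field k] [AddCommGroup V] [Module k V] (φ : V →ₗ[k] V) :
    SymmetricAlgebra k V →ₐ[k] SymmetricAlgebra k V :=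
  SymmetricAlgebra.lift (SymmetricAlgebra.ι k V ∘ₗ φ)

theorem symMap_ι {k V : Type*} [Field k] [AddCommGroup V] [Module k V] (φ : V →ₗ[k] V) (v : V) :
    symMap φ (SymmetricAlgebra.ι k V v) = SymmetricAlgebra.ι k V (φ v) := by
  simp [symMap]

theorem symMap_one {k V : Type*} [Field k] [AddCommGroup V] [Module k V] :
    symMap (1 : V →ₗ[k] V) = AlgHom.id k (SymmetricAlgebra k V) := by
  apply SymmetricAlgebra.algHom_ext
  ext v
  simp [symMap_ι]

theorem symMap_symMap {k V : Type*} [Field k] [AddCommGroup V] [Module k V] (φ ψ : V →ₗ[k] V)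
    (P : SymmetricAlgebra k V) : symMap φ (symMap ψ P) = symMap (φ * ψ) P := by
  have h : (symMap φ).comp (symMap ψ) = symMap (φ * ψ) := by
    apply SymmetricAlgebra.algHom_ext
    ext v
    simp [symMap_ι]
  exact DFunLike.congr_fun h P

/-- For a subspace `U` of `S(V)`, the subalgebra of `S(V)` generated by `U`. -/
def symSpan {k V : Type*} [Field k] [AddCommGroup V] [Module k V]
    (U : Submodule k (SymmetricAlgebra k V)) : Subalgebra k (SymmetricAlgebra k V) :=
  Algebra.adjoin k (U : Set (SymmetricAlgebra k V))

/-- `S(W)` as a subalgebra of `S(V)`, for a subspace `W` of `V`. -/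
def symSub {k V : Type*} [Field k] [AddCommGroup V] [Module k V] (W : Submodule k V) :
    Subalgebra k (SymmetricAlgebra k V) :=
  symSpan (W.map (SymmetricAlgebra.ι k V))

/-- `S(k x^l ⊕ W)` as a subalgebra of `S(V)`, for a vector `x` and a subspace `W` of `V`. -/
def symSubPow {k V : Type*} [Field k] [AddCommGroup V] [Module k V] (x : V) (l : ℕ)
    (W : Submodule k V) : Subalgebra k (SymmetricAlgebra k V) :=
  symSpan ((k ∙ (SymmetricAlgebra.ι k V x) ^ l) ⊔ W.map (SymmetricAlgebra.ι k V))

/-- A normal 2-cocycle `f : G × G → kˣ` (the action of `G` on `kˣ` is trivial). -/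
structure NormalCocycle (G k : Type*) [Group G] [Field k] where
  toFun : G → G → kˣ
  cocycle : ∀ g h m, toFun g h * toFun (g * h) m = toFun h m * toFun g (h * m)
  one_left : ∀ g, toFun 1 g = 1
  one_right : ∀ g, toFun g 1 = 1

/-- The crossed product `S(V) #_f G`: the free left `S(V)`-module on the symbols `w_g`, `g ∈ G`. -/
def CrossedProduct {k G V : Type*} [Field k] [Group G] [AddCommGroup V] [Module k V]
    (_ρ : Representation k G V) (_f : NormalCocycle G k) : Type _ :=
  G →₀ SymmetricAlgebra k V

namespace CrossedProduct

variable {k G V : Type*} [Field k] [Group G] [AddCommGroup V] [Module k V]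
  {ρ : Representation k G V} {f : NormalCocycle G k}

instance : AddCommGroup (CrossedProduct ρ f) :=
  inferInstanceAs (AddCommGroup (G →₀ SymmetricAlgebra k V))

instance : Module k (CrossedProduct ρ f) :=
  inferInstanceAs (Module k (G →₀ SymmetricAlgebra k V))

/-- The element `P w_g`, as a linear function of `P ∈ S(V)`. -/
def mono (g : G) : SymmetricAlgebra k V →ₗ[k] CrossedProduct ρ f :=
  Finsupp.lsingle (R := k) g

theorem induction_mono {p : CrossedProduct ρ f → Prop} (a : CrossedProduct ρ f) (h0 : p 0)
    (hadd : ∀ a b, p a → p b → p (a + b)) (hm : ∀ g P, p (mono g P)) : p a :=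
  Finsupp.induction_linear a h0 hadd hm

/-- The linear map on `S(V) #_f G` with prescribed values `P w_g ↦ F g P`. -/
def liftMono {M : Type*} [AddCommGroup M] [Module k M] (F : G → SymmetricAlgebra k V →ₗ[k] M) :
    CrossedProduct ρ f →ₗ[k] M :=
  Finsupp.lsum k F

theorem liftMono_mono {M : Type*} [AddCommGroup M] [Module k M]
    (F : G → SymmetricAlgebra k V →ₗ[k] M) (g : G) (P : SymmetricAlgebra k V) :
    liftMono F (mono g P : CrossedProduct ρ f) = F g P :=
  Finsupp.lsum_single k F g P

/-- The linear endomorphism `v₁ ⋯ v_m w_g ↦ φ(v₁) ⋯ φ(v_m) χ(g) w_g` of `S(V) #_f G`. -/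
def diag (φ : V →ₗ[k] V) (χ : G →* kˣ) : CrossedProduct ρ f →ₗ[k] CrossedProduct ρ f :=
  liftMono fun g => ((χ g : kˣ) : k) • (mono g ∘ₗ (symMap φ).toLinearMap)

theorem diag_mono (φ : V →ₗ[k] V) (χ : G →* kˣ) (g : G) (P : SymmetricAlgebra k V) :
    diag φ χ (mono g P : CrossedProduct ρ f) = ((χ g : kˣ) : k) • mono g (symMap φ P) := by
  simp [diag, liftMono_mono]

theorem diag_diag (φ ψ : V →ₗ[k] V) (χ θ : G →* kˣ) (hφ : φ * ψ = 1) (hχ : χ * θ = 1)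
    (a : CrossedProduct ρ f) : diag φ χ (diag ψ θ a) = a := by
  induction a using induction_mono with
  | h0 => simp
  | hadd a b h h' => rw [map_add, map_add, h, h']
  | hm g P =>
    have h1 : ((θ g : kˣ) : k) * ((χ g : kˣ) : k) = 1 := by
      rw [mul_comm]
      simpa using congrArg Units.val (DFunLike.congr_fun hχ g)
    rw [diag_mono, map_smul, diag_mono, symMap_symMap, hφ, symMap_one, smul_smul, h1, one_smul]
    rfl

/-- The bijection `α` of `S(V) #_f G` determined by a linear automorphism `φ` of `V` and a
character `χ` of `G`: `α(v₁ ⋯ v_m w_g) = φ(v₁) ⋯ φ(v_m) χ(g) w_g`. -/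
def diagEquiv (φ : V ≃ₗ[k] V) (χ : G →* kˣ) : CrossedProduct ρ f ≃ₗ[k] CrossedProduct ρ f :=
  { diag φ.toLinearMap χ with
    invFun := diag φ.symm.toLinearMap χ⁻¹
    left_inv := diag_diag _ _ _ _ (LinearMap.ext φ.symm_apply_apply) (inv_mul_cancel χ)
    right_inv := diag_diag _ _ _ _ (LinearMap.ext φ.apply_symm_apply) (mul_inv_cancel χ) }

/-- The product of `S(V) #_f G` as a bilinear map. -/
def mulLin : CrossedProduct ρ f →ₗ[k] CrossedProduct ρ f →ₗ[k] CrossedProduct ρ f :=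
  liftMono fun g => LinearMap.flip (liftMono fun h => LinearMap.flip
    (((LinearMap.mul k (SymmetricAlgebra k V)).compl₂ (symMap (ρ g)).toLinearMap).compr₂
      (((f.toFun g h : kˣ) : k) • mono (g * h))))

instance : Mul (CrossedProduct ρ f) := ⟨fun a b => mulLin a b⟩

instance : One (CrossedProduct ρ f) := ⟨mono 1 1⟩

theorem mul_def (a b : CrossedProduct ρ f) : a * b = mulLin a b := rfl

theorem one_def : (1 : CrossedProduct ρ f) = mono 1 1 := rfl

/-- `(P w_g)(Q w_h) = P ᵍQ f(g,h) w_{gh}`. -/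
theorem mono_mul_mono (g h : G) (P Q : SymmetricAlgebra k V) :
    (mono g P * mono h Q : CrossedProduct ρ f) =
      mono (g * h) (((f.toFun g h : kˣ) : k) • (P * symMap (ρ g) Q)) := by
  simp [mul_def, mulLin, liftMono_mono]

instance : Ring (CrossedProduct ρ f) :=
  { (inferInstance : AddCommGroup (CrossedProduct ρ f)),
    (inferInstance : Mul (CrossedProduct ρ f)),
    (inferInstance : One (CrossedProduct ρ f)) with
    left_distrib := fun a b c => by simp [mul_def]
    right_distrib := fun a b c => by simp [mul_def]
    zero_mul := fun a => by simp [mul_def]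
    mul_zero := fun a => by simp [mul_def]
    mul_assoc := fun a b c => by
      induction a using induction_mono with
      | h0 => simp [mul_def]
      | hadd a a' h h' => simp only [mul_def, map_add, LinearMap.add_apply] at h h' ⊢; rw [h, h']
      | hm g P =>
      induction b using induction_mono with
      | h0 => simp [mul_def]
      | hadd a a' h h' => simp only [mul_def, map_add, LinearMap.add_apply] at h h' ⊢; rw [h, h']
      | hm h Q =>
      induction c using induction_mono with
      | h0 => simp [mul_def]
      | hadd a a' h h' => simp only [mul_def, map_add] at h h' ⊢; rw [h, h']
      | hm m R =>
      have hc : ((f.toFun (g * h) m : kˣ) : k) * ((f.toFun g h : kˣ) : k) =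
          ((f.toFun g (h * m) : kˣ) : k) * ((f.toFun h m : kˣ) : k) := by
        rw [mul_comm, mul_comm (((f.toFun g (h * m) : kˣ) : k))]
        exact_mod_cast congrArg Units.val (f.cocycle g h m)
      have hs : ∀ (r : k) (a b : CrossedProduct ρ f), (r • a) * b = r • (a * b) :=
        fun r a b => by simp [mul_def]
      have hs' : ∀ (r : k) (a b : CrossedProduct ρ f), a * (r • b) = r • (a * b) :=
        fun r a b => by simp [mul_def]
      simp only [mono_mul_mono, mul_assoc, map_smul, map_mul, hs, hs', smul_smul, symMap_symMap]
      rw [mul_comm ((f.toFun g h : kˣ) : k), mul_comm ((f.toFun h m : kˣ) : k), hc]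
    one_mul := fun a => by
      induction a using induction_mono with
      | h0 => simp [mul_def]
      | hadd a a' h h' => simp only [mul_def, map_add] at h h' ⊢; rw [h, h']
      | hm g P => simp [one_def, mono_mul_mono, f.one_left, symMap_one]
    mul_one := fun a => by
      induction a using induction_mono with
      | h0 => simp [mul_def]
      | hadd a a' h h' => simp only [mul_def, map_add, LinearMap.add_apply] at h h' ⊢; rw [h, h']
      | hm g P => simp [one_def, mono_mul_mono, f.one_right] }

instance : Algebra k (CrossedProduct ρ f) :=
  Algebra.ofModule (fun r a b => by simp [mul_def]) (fun r a b => by simp [mul_def])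

/-- `δ₁(v₁ ⋯ v_m w_g) = ∑_j α(v₁ ⋯ v_{j-1}) δ̂₁(v_j) ς(v_{j+1} ⋯ v_m w_g)`
for all `v₁, …, v_m ∈ V` and `g ∈ G`. -/
def IsDelta₁ (α : CrossedProduct ρ f ≃ₗ[k] CrossedProduct ρ f)
    (ς : CrossedProduct ρ f →ₗ[k] CrossedProduct ρ f) (δhat : V →ₗ[k] CrossedProduct ρ f)
    (δ : Module.End k (CrossedProduct ρ f)) : Prop :=
  ∀ (m : ℕ) (v : Fin m → V) (g : G),
    δ (mono g (∏ i, SymmetricAlgebra.ι k V (v i))) =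
      ∑ j, α (mono 1 (∏ i ∈ Finset.Iio j, SymmetricAlgebra.ι k V (v i))) * δhat (v j) *
        ς (mono g (∏ i ∈ Finset.Ioi j, SymmetricAlgebra.ι k V (v i)))

/-- `δ₂(v₁ ⋯ v_m w_g) = ∑_j ς(α⁻¹(v₁ ⋯ v_{j-1})) δ̂₂(v_j) v_{j+1} ⋯ v_m w_g`
for all `v₁, …, v_m ∈ V` and `g ∈ G`. -/
def IsDelta₂ (α : CrossedProduct ρ f ≃ₗ[k] CrossedProduct ρ f)
    (ς : CrossedProduct ρ f →ₗ[k] CrossedProduct ρ f) (δhat : V →ₗ[k] CrossedProduct ρ f)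
    (δ : Module.End k (CrossedProduct ρ f)) : Prop :=
  ∀ (m : ℕ) (v : Fin m → V) (g : G),
    δ (mono g (∏ i, SymmetricAlgebra.ι k V (v i))) =
      ∑ j, ς (α.symm (mono 1 (∏ i ∈ Finset.Iio j, SymmetricAlgebra.ι k V (v i)))) * δhat (v j) *
        mono g (∏ i ∈ Finset.Ioi j, SymmetricAlgebra.ι k V (v i))

end CrossedProduct

end BraidedDeformation

end

/-! Let `∂ᵢ` be the `q`-derivative of `S(V)` along `xᵢ`: it is `1` on `xᵢ`, `0` on `Vᵢ`, and
satisfies `∂ᵢ(FH) = ∂ᵢF · σᵢ(H) + F · ∂ᵢH`, where `σᵢ` multiplies `xᵢ` by `q` and fixes `Vᵢ`. The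
conditions on `ς` and the eigenvalues give `g₁ ς = α σ₁` and `ς α⁻¹ = g₂ σ₂` on `V`. Hence, up to
nonzero scalars, `δ₁(F w_g) = P₁ α(∂₁F) w_{g₁g}` and `δ₂(F w_g) = P₂ ᵍ²(∂₂F) w_{g₂g}`
(`isDelta₁_twistedQDeriv`, `isDelta₂_twistedQDeriv`). Uniqueness holds because the products `v₁ ⋯
v_m w_g` span.

As `S(V)` is a domain and `Pᵢ ≠ 0`, the condition `δ₂(P₁) = 0` means `∂₂P₁ = 0`, and likewise for
`δ₁(P₂)`. Writing `S(V) = S(Vᵢ)[xᵢ]`, the derivative sends `a xᵢⁿ` to `[n] a xᵢⁿ⁻¹` with `[n] = 1 +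
q + ⋯ + qⁿ⁻¹`, so its kernel is read off from the vanishing `q`-integers. For (1), `∂ᵢ` kills `Pᵢ`
and commutes with the twist up to a scalar, so `∂ᵢ^l = 0` forces `δᵢ^l = 0`. -/

noncomputable section

namespace BraidedDeformation

open Polynomial

/-! ### The `q`-derivative of polynomials in one variable. -/

section QDerivativePolynomial

variable {k R : Type*} [Field k] [CommRing R] [Algebra k R]

/-- The `q`-derivative `a X^n ↦ (1 + q + ⋯ + q^(n-1)) a X^(n-1)` of polynomials. -/
def polyQDeriv (q : k) : R[X] →ₗ[k] R[X] :=
  Polynomial.lsum fun n => (∑ i ∈ Finset.range n, q ^ i) • (monomial (n - 1)).restrictScalars k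

theorem polyQDeriv_monomial (q : k) (n : ℕ) (a : R) :
    polyQDeriv q (monomial n a) = monomial (n - 1) ((∑ i ∈ Finset.range n, q ^ i) • a) := by
  rw [polyQDeriv, Polynomial.lsum_apply, Polynomial.sum_monomial_index _ _ (by simp),
    ← smul_monomial]
  rfl

theorem coeff_polyQDeriv (q : k) (p : R[X]) (n : ℕ) :
    (polyQDeriv q p).coeff n = (∑ i ∈ Finset.range (n + 1), q ^ i) • p.coeff (n + 1) := by
  induction p using Polynomial.induction_on' with
  | add p r hp hr => simp [hp, hr]
  | monomial m a =>
    rw [polyQDeriv_monomial, coeff_monomial, coeff_monomial]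
    -- For `m = 0` the truncated exponent `m - 1` is harmless, since the coefficient is an empty
    -- sum.
    rcases m with _ | m
    · simp
    · by_cases h : m = n
      · simp [h]
      · simp [h]

/-- The twisted Leibniz rule, which rests on `[m + n] = [m] qⁿ + [n]`. After evaluation at `y`, the
twist `X ↦ qX` becomes evaluation at `q • y`. -/
theorem eval_polyQDeriv_mul (q : k) (y : R) (p r : R[X]) :
    (polyQDeriv q (p * r)).eval y =
      (polyQDeriv q p).eval y * r.eval (q • y) + p.eval y * (polyQDeriv q r).eval y := by
  induction p using Polynomial.induction_on' with
  | add p p' hp hp' => simp only [add_mul, map_add, eval_add, hp, hp']; ring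
  | monomial m a =>
    induction r using Polynomial.induction_on' with
    | add r r' hr hr' => simp only [mul_add, map_add, eval_add, hr, hr']; ring
    | monomial n b =>
      simp only [monomial_mul_monomial, polyQDeriv_monomial, eval_monomial]
      have hs : ∑ i ∈ Finset.range (m + n), q ^ i =
          (∑ i ∈ Finset.range m, q ^ i) * q ^ n + ∑ i ∈ Finset.range n, q ^ i := by
        rw [add_comm m n, Finset.sum_range_add, Finset.sum_mul, add_comm]
        congr 1
        exact Finset.sum_congr rfl fun i _ => by ring
      rw [hs]
      simp only [Algebra.smul_def, map_add, map_mul, map_pow, mul_pow]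
      rcases m with _ | m
      · simp; ring
      rcases n with _ | n
      · simp; ring
      have h : m + 1 + (n + 1) - 1 = m + n + 1 := by omega
      rw [h]
      simp only [Nat.add_sub_cancel]
      ring

theorem coeff_polyQDeriv_pow (q : k) (l : ℕ) (p : R[X]) (n : ℕ) :
    ((polyQDeriv q ^ l) p).coeff n =
      (∏ j ∈ Finset.range l, ∑ i ∈ Finset.range (n + j + 1), q ^ i) • p.coeff (n + l) := by
  induction l generalizing p with
  | zero => simp
  | succ l ih =>
    rw [pow_succ, Module.End.mul_apply, ih, coeff_polyQDeriv, smul_smul, Finset.prod_range_succ]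
    rfl

theorem geom_sum_eq_zero_of_pow_eq_one {q : k} (hq : q ≠ 1) {n : ℕ} (h : q ^ n = 1) :
    ∑ i ∈ Finset.range n, q ^ i = 0 := by
  rw [geom_sum_eq hq, h, sub_self, zero_div]

theorem pow_eq_one_of_geom_sum_eq_zero {q : k} {n : ℕ}
    (h : ∑ i ∈ Finset.range n, q ^ i = 0) : q ^ n = 1 := by
  have := geom_sum_mul q n
  rw [h, zero_mul] at this
  exact (sub_eq_zero.mp this.symm)

/-- The `l`-th power introduces a product of `l` consecutive `q`-integers, one of which has index
divisible by `l` and so vanishes. -/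
theorem polyQDeriv_pow_eq_zero {q : k} (hq : q ≠ 1) {l : ℕ} (hl : 0 < l) (h : q ^ l = 1) :
    (polyQDeriv q : R[X] →ₗ[k] R[X]) ^ l = 0 := by
  refine LinearMap.ext fun p => Polynomial.ext fun n => ?_
  rw [coeff_polyQDeriv_pow]
  -- This `j` makes `n + j + 1` the first multiple of `l` above `n`.
  have hj : l - 1 - n % l ∈ Finset.range l := Finset.mem_range.mpr (by omega)
  rw [Finset.prod_eq_zero hj, zero_smul]
  · simp
  · apply geom_sum_eq_zero_of_pow_eq_one hq
    have hlt := Nat.mod_lt n hl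
    have hn : n + (l - 1 - n % l) + 1 = l * (n / l + 1) := by
      have := Nat.div_add_mod n l
      rw [mul_add, mul_one]
      omega
    rw [hn, pow_mul, h, one_pow]

end QDerivativePolynomial

/-! ### The `q`-derivative on `S(V)`, its kernel and its powers. -/

section QDerivative

variable {k V : Type*} [Field k] [AddCommGroup V] [Module k V]

theorem ι_mem_symSub {W : Submodule k V} {v : V} (hv : v ∈ W) :
    SymmetricAlgebra.ι k V v ∈ symSub W :=
  Algebra.subset_adjoin ⟨v, hv, rfl⟩

theorem symSub_le {W : Submodule k V} {A : Subalgebra k (SymmetricAlgebra k V)}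
    (h : ∀ v ∈ W, SymmetricAlgebra.ι k V v ∈ A) : symSub W ≤ A := by
  refine Algebra.adjoin_le ?_
  rintro _ ⟨v, hv, rfl⟩
  exact h v hv

theorem symSub_top : symSub (⊤ : Submodule k V) = ⊤ := by
  refine top_unique fun F _ => ?_
  induction F using SymmetricAlgebra.induction with
  | algebraMap r => exact Subalgebra.algebraMap_mem _ r
  | ι v => exact ι_mem_symSub trivial
  | mul a b ha hb => exact mul_mem (ha trivial) (hb trivial)
  | add a b ha hb => exact add_mem (ha trivial) (hb trivial)

theorem symMap_injective {φ ψ : V →ₗ[k] V} (h : ψ * φ = 1) :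
    Function.Injective (symMap φ) := fun F F' e => by
  have := congrArg (symMap ψ) e
  rwa [symMap_symMap, symMap_symMap, h, symMap_one] at this

/-- The expansion of elements of `S(V)` as polynomials in `x` with coefficients in `S(ker c)`,
for a linear form `c` with `c x = 1`. -/
def expand (x : V) (c : V →ₗ[k] k) : SymmetricAlgebra k V →ₐ[k] (SymmetricAlgebra k V)[X] :=
  SymmetricAlgebra.lift
    ((CAlgHom (R := k)).toLinearMap ∘ₗ SymmetricAlgebra.ι k V ∘ₗ
      (LinearMap.id - c.smulRight x) + c.smulRight X)

/-- The linear map that multiplies `x` by `q` and is the identity on `ker c`. -/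
def scaleAlong (q : k) (x : V) (c : V →ₗ[k] k) : V →ₗ[k] V :=
  LinearMap.id + (q - 1) • c.smulRight x

theorem scaleAlong_apply (q : k) (x : V) (c : V →ₗ[k] k) (v : V) :
    scaleAlong q x c v = v + ((q - 1) * c v) • x := by
  simp [scaleAlong, smul_smul]

theorem expand_ι (x : V) (c : V →ₗ[k] k) (v : V) :
    expand x c (SymmetricAlgebra.ι k V v) =
      C (SymmetricAlgebra.ι k V (v - c v • x)) + c v • X := by
  simp [expand]

theorem expand_ι_self {x : V} {c : V →ₗ[k] k} (hx : c x = 1) :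
    expand x c (SymmetricAlgebra.ι k V x) = X := by
  simp [expand_ι, hx]

/-- Both sides are algebra maps in `F` that agree on `V`. This turns the twist in the polynomial
Leibniz rule into `scaleAlong`; the case `q = 1` recovers `F` from its expansion. -/
theorem eval_smul_expand (q : k) (x : V) (c : V →ₗ[k] k) (F : SymmetricAlgebra k V) :
    (expand x c F).eval (q • SymmetricAlgebra.ι k V x) = symMap (scaleAlong q x c) F := by
  induction F using SymmetricAlgebra.induction with
  | algebraMap r => simp [Polynomial.algebraMap_apply]
  | ι v =>
    rw [expand_ι, symMap_ι, scaleAlong_apply, eval_add, eval_C]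
    simp only [eval_smul, eval_X, map_add, map_sub, map_smul, smul_smul,
      sub_mul, one_mul, sub_smul, mul_comm q]
    abel
  | mul a b ha hb => simp [ha, hb]
  | add a b ha hb => simp [ha, hb]

theorem eval_expand (x : V) (c : V →ₗ[k] k) (F : SymmetricAlgebra k V) :
    (expand x c F).eval (SymmetricAlgebra.ι k V x) = F := by
  have h := eval_smul_expand 1 x c F
  have h1 : scaleAlong 1 x c = 1 := LinearMap.ext fun v => by simp [scaleAlong_apply]
  rwa [one_smul, h1, symMap_one] at h

theorem expand_of_mem_ker (x : V) {c : V →ₗ[k] k} {F : SymmetricAlgebra k V}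
    (hF : F ∈ symSub (LinearMap.ker c)) : expand x c F = C F := by
  have : symSub (LinearMap.ker c) ≤ AlgHom.equalizer (expand x c) CAlgHom :=
    symSub_le fun v hv => by
      have hv' : c v = 0 := hv
      simp [AlgHom.mem_equalizer, expand_ι, hv']
  exact this hF

/-- Needed for `U = V`, `W = ker c`, and for `U = V₁` or `V₂`, `W = V₁ ∩ V₂`, where the other
hyperplane is the kernel of `c`. -/
theorem coeff_expand_mem {x : V} {c : V →ₗ[k] k} {U W : Submodule k V}
    (hUW : ∀ u ∈ U, u - c u • x ∈ W) {F : SymmetricAlgebra k V} (hF : F ∈ symSub U) (n : ℕ) :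
    (expand x c F).coeff n ∈ symSub W := by
  induction hF using Algebra.adjoin_induction generalizing n with
  | mem a ha =>
    obtain ⟨v, hv, rfl⟩ := ha
    rw [expand_ι, coeff_add, coeff_C, coeff_smul, coeff_X]
    refine add_mem ?_ (Subalgebra.smul_mem _ ?_ _)
    · split_ifs
      · exact ι_mem_symSub (hUW v hv)
      · exact zero_mem _
    · split_ifs
      · exact one_mem _
      · exact zero_mem _
  | algebraMap r =>
    rw [AlgHom.commutes, Polynomial.algebraMap_apply, coeff_C]
    split_ifs
    · exact Subalgebra.algebraMap_mem _ r
    · exact zero_mem _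
  | add a b _ _ ha hb => rw [map_add, coeff_add]; exact add_mem (ha n) (hb n)
  | mul a b _ _ ha hb =>
    rw [map_mul, coeff_mul]
    exact sum_mem fun i _ => mul_mem (ha _) (hb _)

theorem expand_eval {x : V} {c : V →ₗ[k] k} (hx : c x = 1) {p : (SymmetricAlgebra k V)[X]}
    (hp : ∀ n, p.coeff n ∈ symSub (LinearMap.ker c)) :
    expand x c (p.eval (SymmetricAlgebra.ι k V x)) = p := by
  conv_rhs => rw [p.as_sum_range_C_mul_X_pow]
  rw [eval_eq_sum_range, map_sum]
  refine Finset.sum_congr rfl fun n _ => ?_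
  rw [map_mul, map_pow, expand_ι_self hx, expand_of_mem_ker x (hp n)]

/-- The `q`-derivative of `S(V)` in the direction of `x`: it is `1` on `x` and `0` on `ker c`. -/
def qDeriv (q : k) (x : V) (c : V →ₗ[k] k) : Module.End k (SymmetricAlgebra k V) :=
  (aeval (R := SymmetricAlgebra k V) (SymmetricAlgebra.ι k V x)).toLinearMap.restrictScalars k ∘ₗ
    polyQDeriv q ∘ₗ (expand x c).toLinearMap

theorem qDeriv_apply (q : k) (x : V) (c : V →ₗ[k] k) (F : SymmetricAlgebra k V) :
    qDeriv q x c F = (polyQDeriv q (expand x c F)).eval (SymmetricAlgebra.ι k V x) := by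
  simp [qDeriv, coe_aeval_eq_eval]

theorem qDeriv_mul (q : k) (x : V) (c : V →ₗ[k] k) (F H : SymmetricAlgebra k V) :
    qDeriv q x c (F * H) =
      qDeriv q x c F * symMap (scaleAlong q x c) H + F * qDeriv q x c H := by
  simp only [qDeriv_apply, map_mul, eval_polyQDeriv_mul, eval_smul_expand, eval_expand]

theorem qDeriv_algebraMap (q : k) (x : V) (c : V →ₗ[k] k) (r : k) :
    qDeriv q x c (algebraMap k _ r) = 0 := by
  rw [qDeriv_apply, AlgHom.commutes, Polynomial.algebraMap_apply, ← monomial_zero_left,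
    polyQDeriv_monomial]
  simp

theorem qDeriv_ι (q : k) (x : V) (c : V →ₗ[k] k) (v : V) :
    qDeriv q x c (SymmetricAlgebra.ι k V v) = algebraMap k _ (c v) := by
  rw [qDeriv_apply, expand_ι, ← monomial_zero_left, ← monomial_one_one_eq_X, map_add, map_smul,
    polyQDeriv_monomial, polyQDeriv_monomial]
  simp [Algebra.smul_def]

theorem expand_qDeriv (q : k) {x : V} {c : V →ₗ[k] k} (hx : c x = 1)
    (F : SymmetricAlgebra k V) :
    expand x c (qDeriv q x c F) = polyQDeriv q (expand x c F) := by
  rw [qDeriv_apply]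
  refine expand_eval hx fun n => ?_
  rw [coeff_polyQDeriv]
  refine Subalgebra.smul_mem _ (coeff_expand_mem (U := ⊤) (fun u _ => ?_) ?_ _) _
  · simp [hx]
  · rw [symSub_top]; trivial

theorem expand_injective (x : V) (c : V →ₗ[k] k) : Function.Injective (expand x c) :=
  Function.LeftInverse.injective (eval_expand x c)

theorem qDeriv_pow_eq_zero {q : k} (hq : q ≠ 1) {l : ℕ} (hl : 0 < l) (h : q ^ l = 1) {x : V}
    {c : V →ₗ[k] k} (hx : c x = 1) : qDeriv q x c ^ l = 0 := by
  have hn : ∀ n F, expand x c ((qDeriv q x c ^ n) F) = (polyQDeriv q ^ n) (expand x c F) := by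
    intro n F
    induction n generalizing F with
    | zero => rfl
    | succ n ih => rw [pow_succ, pow_succ, Module.End.mul_apply, ih, expand_qDeriv q hx]; rfl
  refine LinearMap.ext fun F => expand_injective x c ?_
  rw [hn, polyQDeriv_pow_eq_zero hq hl h]
  simp

/-- The elements killed by the `q`-derivative and fixed by the corresponding scaling. -/
def qConstants (q : k) (x : V) (c : V →ₗ[k] k) : Subalgebra k (SymmetricAlgebra k V) where
  carrier := {F | qDeriv q x c F = 0 ∧ symMap (scaleAlong q x c) F = F}
  mul_mem' := fun {a b} ha hb => ⟨by rw [qDeriv_mul, ha.1, hb.1]; simp,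
    by rw [map_mul, ha.2, hb.2]⟩
  add_mem' := fun {a b} ha hb => ⟨by rw [map_add, ha.1, hb.1, add_zero],
    by rw [map_add, ha.2, hb.2]⟩
  algebraMap_mem' := fun r => ⟨qDeriv_algebraMap q x c r, AlgHom.commutes _ r⟩

theorem symSub_le_qConstants (q : k) (x : V) (c : V →ₗ[k] k) {W : Submodule k V}
    (hW : W ≤ LinearMap.ker c) : symSub W ≤ qConstants q x c := by
  refine symSub_le fun v hv => ?_
  have hv' : c v = 0 := hW hv
  exact ⟨by rw [qDeriv_ι, hv', map_zero], by rw [symMap_ι, scaleAlong_apply, hv']; simp⟩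

/-- `[l] = 0` kills the derivative of `x^l` and also forces `q^l = 1`, so the scaling fixes `x^l`.
Requiring invariance under the scaling makes the constants visibly a subalgebra. -/
theorem symSubPow_le_qConstants {q : k} {x : V} {c : V →ₗ[k] k} (hx : c x = 1) {l : ℕ}
    (hl : ∑ i ∈ Finset.range l, q ^ i = 0) {W : Submodule k V}
    (hW : W ≤ LinearMap.ker c) : symSubPow x l W ≤ qConstants q x c := by
  refine Algebra.adjoin_le ?_
  have : (k ∙ (SymmetricAlgebra.ι k V x) ^ l) ⊔ W.map (SymmetricAlgebra.ι k V) ≤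
      Subalgebra.toSubmodule (qConstants q x c) := by
    refine sup_le ?_ ?_
    · rw [Submodule.span_singleton_le_iff_mem]
      refine ⟨?_, ?_⟩
      · rw [qDeriv_apply, map_pow, expand_ι_self hx, X_pow_eq_monomial, polyQDeriv_monomial, hl]
        simp
      · rw [map_pow, symMap_ι, scaleAlong_apply, hx, mul_one, sub_smul, one_smul,
          add_sub_cancel, map_smul, _root_.smul_pow, pow_eq_one_of_geom_sum_eq_zero hl, one_smul]
    · rintro _ ⟨v, hv, rfl⟩
      exact symSub_le_qConstants q x c hW (ι_mem_symSub hv)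
  exact this

theorem coeff_expand_eq_zero_of_qDeriv {q : k} {x : V} {c : V →ₗ[k] k} (hx : c x = 1)
    {F : SymmetricAlgebra k V} (hF : qDeriv q x c F = 0) {n : ℕ}
    (hn : ∑ i ∈ Finset.range n, q ^ i ≠ 0) : (expand x c F).coeff n = 0 := by
  rcases n with _ | n
  · simp at hn
  have h := congrArg (coeff · n) (expand_qDeriv q hx F)
  simp only [hF, map_zero, coeff_zero, coeff_polyQDeriv] at h
  exact (smul_eq_zero.mp h.symm).resolve_left hn

/-- If no `q`-integer vanishes, the `q`-constants of `S(U)` are the elements of `S(U ∩ ker c)`. -/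
theorem qDeriv_eq_zero_iff_mem_symSub {q : k} {x : V} {c : V →ₗ[k] k} (hx : c x = 1)
    (hq : ∀ n, 0 < n → ∑ i ∈ Finset.range n, q ^ i ≠ 0) {U W : Submodule k V}
    (hUW : ∀ u ∈ U, u - c u • x ∈ W) (hW : W ≤ LinearMap.ker c)
    {F : SymmetricAlgebra k V} (hF : F ∈ symSub U) :
    qDeriv q x c F = 0 ↔ F ∈ symSub W := by
  refine ⟨fun h => ?_, fun h => (symSub_le_qConstants q x c hW h).1⟩
  rw [← eval_expand x c F, eval_eq_sum_range]
  refine sum_mem fun n _ => ?_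
  -- In the expansion of `F` in powers of `x` only the constant term survives, and its coefficient
  -- lies in `S(W)`.
  rcases Nat.eq_zero_or_pos n with rfl | hn
  · rw [pow_zero, mul_one]
    exact coeff_expand_mem hUW hF 0
  · rw [coeff_expand_eq_zero_of_qDeriv hx h (hq n hn), zero_mul]
    exact zero_mem _

/-- If the vanishing `q`-integers are those divisible by `l`, the `q`-constants of `S(U)` are the
elements of `S(k x^l ⊕ (U ∩ ker c))`. -/
theorem qDeriv_eq_zero_iff_mem_symSubPow {q : k} {x : V} {c : V →ₗ[k] k} (hx : c x = 1) {l : ℕ}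
    (hq : ∀ n, ∑ i ∈ Finset.range n, q ^ i = 0 ↔ l ∣ n) {U W : Submodule k V}
    (hUW : ∀ u ∈ U, u - c u • x ∈ W) (hW : W ≤ LinearMap.ker c)
    {F : SymmetricAlgebra k V} (hF : F ∈ symSub U) :
    qDeriv q x c F = 0 ↔ F ∈ symSubPow x l W := by
  refine ⟨fun h => ?_,
    fun h => (symSubPow_le_qConstants hx ((hq l).mpr dvd_rfl) hW h).1⟩
  rw [← eval_expand x c F, eval_eq_sum_range]
  refine sum_mem fun n _ => ?_
  by_cases hn : l ∣ n
  · obtain ⟨m, rfl⟩ := hn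
    refine mul_mem ?_ ?_
    · have hle : symSub W ≤ symSubPow x l W := symSub_le fun v hv =>
        Algebra.subset_adjoin (Submodule.mem_sup_right ⟨v, hv, rfl⟩)
      exact hle (coeff_expand_mem hUW hF _)
    · rw [pow_mul]
      exact pow_mem (Algebra.subset_adjoin
        (Submodule.mem_sup_left (Submodule.mem_span_singleton_self _))) m
  · rw [coeff_expand_eq_zero_of_qDeriv hx h (mt (hq n).mp hn), zero_mul]
    exact zero_mem _

/-- `φ` commutes with the scaling, so both sides obey the same twisted Leibniz rule and need only be
compared on `V`. -/
theorem qDeriv_symMap {q a : k} {x : V} {c : V →ₗ[k] k} {φ : V →ₗ[k] V} (hφx : φ x = a • x)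
    (hφ : ∀ v, c (φ v) = a * c v) (F : SymmetricAlgebra k V) :
    qDeriv q x c (symMap φ F) = a • symMap φ (qDeriv q x c F) := by
  have hs : scaleAlong q x c * φ = φ * scaleAlong q x c := LinearMap.ext fun v => by
    simp only [Module.End.mul_apply, scaleAlong_apply, map_add, map_smul, hφx, hφ, smul_smul]
    congr 2
    ring
  induction F using SymmetricAlgebra.induction with
  | algebraMap r => simp [qDeriv_algebraMap]
  | ι v => simp [symMap_ι, qDeriv_ι, hφ, Algebra.smul_def]
  | mul F H hF hH =>
    simp only [map_mul, map_add, qDeriv_mul, hF, hH, symMap_symMap, hs, smul_add, smul_mul_assoc,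
      mul_smul_comm]
  | add F H hF hH => simp only [map_add, hF, hH, smul_add]

/-- The twist in the Leibniz rule falls on the right factor, so a left factor killed by the
derivative can be pulled out unchanged. -/
theorem qDeriv_pow_mul_symMap {q a : k} {x : V} {c : V →ₗ[k] k} {φ : V →ₗ[k] V}
    (hφx : φ x = a • x) (hφ : ∀ v, c (φ v) = a * c v) {P : SymmetricAlgebra k V}
    (hP : qDeriv q x c P = 0) (F : SymmetricAlgebra k V) (n : ℕ) :
    (qDeriv q x c ^ n) (P * symMap φ F) = a ^ n • (P * symMap φ ((qDeriv q x c ^ n) F)) := by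
  induction n generalizing F with
  | zero => simp
  | succ n ih =>
    rw [pow_succ, Module.End.mul_apply, Module.End.mul_apply, qDeriv_mul, hP, zero_mul, zero_add,
      qDeriv_symMap hφx hφ, mul_smul_comm, map_smul, ih, smul_smul, pow_succ']

theorem map_prod_of_skew_leibniz {R S : Type*} [CommRing R] [CommRing S] (D : R →+ S)
    (a b : R →* S) (hD : ∀ F H, D (F * H) = D F * b H + a F * D H)
    (m : ℕ) (v : Fin m → R) :
    D (∏ i, v i) = ∑ j, a (∏ i ∈ Finset.Iio j, v i) * D (v j) * b (∏ i ∈ Finset.Ioi j, v i) := by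
  induction m with
  | zero =>
    -- This gives `D 1 = D 1 + D 1`, hence `D 1 = 0`, the value on the empty product.
    have h := hD 1 1
    simp only [mul_one, map_one, one_mul] at h
    simpa using h
  | succ m ih =>
    have hI : ∀ j : Fin m, Finset.Iio j.succ =
        Finset.cons 0 ((Finset.Iio j).map (Fin.succEmb m)) (by simp) := fun j => by
      ext i
      refine Fin.cases ?_ (fun i => ?_) i <;> simp
    rw [Fin.prod_univ_succ, hD, ih, Fin.sum_univ_succ, Finset.mul_sum]
    congr 1
    · have h0 : Finset.Iio (0 : Fin (m + 1)) = ∅ := by ext i; simp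
      rw [Fin.prod_Ioi_zero, h0]
      simp
    · refine Finset.sum_congr rfl fun j _ => ?_
      rw [Fin.prod_Ioi_succ, hI, Finset.prod_cons, Finset.prod_map, map_mul]
      simp only [Fin.coe_succEmb]
      ring

end QDerivative

/-! ### Hyperplanes as kernels of normalised linear forms. -/

theorem exists_dual_eq_one_of_finrank_quotient {k V : Type*} [Field k] [AddCommGroup V]
    [Module k V] {U : Submodule k V} (hU : Module.finrank k (V ⧸ U) = 1) {x : V} (hx : x ∉ U) :
    ∃ c : V →ₗ[k] k, c x = 1 ∧ LinearMap.ker c = U := by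
  have hx0 : U.mkQ x ≠ 0 := by simpa using hx
  have hs := (finrank_eq_one_iff_of_nonzero' _ hx0).mp hU
  obtain ⟨f, hf⟩ := Module.Projective.exists_dual_ne_zero k hx0
  refine ⟨(f (U.mkQ x))⁻¹ • f ∘ₗ U.mkQ, by simpa using inv_mul_cancel₀ hf, ?_⟩
  ext v
  obtain ⟨r, hr⟩ := hs (U.mkQ v)
  rw [← Submodule.Quotient.mk_eq_zero U, ← Submodule.mkQ_apply, LinearMap.mem_ker]
  simp only [LinearMap.smul_apply, LinearMap.comp_apply, smul_eq_mul, ← hr, map_smul]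
  simp [hf, hx0, -Submodule.mkQ_apply]

theorem sub_dual_smul_mem_ker {k V : Type*} [Field k] [AddCommGroup V] [Module k V]
    {c : V →ₗ[k] k} {x : V} (hx : c x = 1) (v : V) : v - c v • x ∈ LinearMap.ker c := by
  simp [hx]

theorem dual_apply_eq_mul {k V : Type*} [Field k] [AddCommGroup V] [Module k V]
    {c : V →ₗ[k] k} {x : V} (hx : c x = 1) {φ : V →ₗ[k] V}
    (hφ : ∀ v ∈ LinearMap.ker c, φ v ∈ LinearMap.ker c) {a : k} (ha : φ x = a • x) (v : V) :
    c (φ v) = a * c v := by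
  have h := hφ _ (sub_dual_smul_mem_ker hx v)
  rw [LinearMap.mem_ker, map_sub, map_smul, map_sub, map_smul, ha, sub_eq_zero] at h
  rw [h]
  simp [hx, mul_comm]

/-! ### Twisted `q`-derivatives on the crossed product. -/

namespace CrossedProduct

variable {k G V : Type*} [Field k] [Group G] [AddCommGroup V] [Module k V]
  {ρ : Representation k G V} {f : NormalCocycle G k}

theorem mono_eq_zero_iff (g : G) (P : SymmetricAlgebra k V) :
    (mono g P : CrossedProduct ρ f) = 0 ↔ P = 0 :=
  Finsupp.single_eq_zero

/-- A linear endomorphism of `S(V) #_f G` is determined by its values on `v₁ ⋯ v_m w_g`. -/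
theorem end_ext_prod {δ δ' : Module.End k (CrossedProduct ρ f)}
    (h : ∀ (m : ℕ) (v : Fin m → V) (g : G),
      δ (mono g (∏ i, SymmetricAlgebra.ι k V (v i))) =
        δ' (mono g (∏ i, SymmetricAlgebra.ι k V (v i)))) : δ = δ' := by
  refine LinearMap.ext fun a => ?_
  induction a using induction_mono with
  | h0 => simp
  | hadd a b ha hb => rw [map_add, map_add, ha, hb]
  | hm g P =>
    have hP : P ∈ Subalgebra.toSubmodule (symSub (⊤ : Submodule k V)) := by
      rw [symSub_top]; trivial
    rw [symSub, symSpan, Algebra.adjoin_eq_span] at hP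
    induction hP using Submodule.span_induction with
    | mem P hP =>
      obtain ⟨l, hl, rfl⟩ := Submonoid.exists_list_of_mem_closure hP
      have hv : ∀ i : Fin l.length, ∃ v, SymmetricAlgebra.ι k V v = l[i] := fun i => by
        obtain ⟨v, -, hv⟩ := hl _ (List.getElem_mem i.2)
        exact ⟨v, hv⟩
      choose v hv using hv
      have := h l.length v g
      simp only [hv] at this
      rwa [← Fin.prod_univ_getElem]
    | zero => simp
    | add P Q _ _ hP hQ => simp only [map_add, hP, hQ]
    | smul r P _ hP => simp only [map_smul, hP]

/-- The linear endomorphism `F w_g ↦ κ(g) P φ(∂F) w_{hg}` of `S(V) #_f G`, where `∂` is the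
`q`-derivative in the direction of `x`. -/
def twistedQDeriv (h : G) (κ : G → k) (P : SymmetricAlgebra k V) (φ : V →ₗ[k] V) (q : k) (x : V)
    (c : V →ₗ[k] k) : Module.End k (CrossedProduct ρ f) :=
  liftMono fun g => κ g • (mono (h * g) ∘ₗ LinearMap.mulLeft k P ∘ₗ (symMap φ).toLinearMap ∘ₗ
    qDeriv q x c)

theorem twistedQDeriv_mono (h : G) (κ : G → k) (P : SymmetricAlgebra k V) (φ : V →ₗ[k] V) (q : k)
    (x : V) (c : V →ₗ[k] k) (g : G) (F : SymmetricAlgebra k V) :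
    twistedQDeriv h κ P φ q x c (mono g F : CrossedProduct ρ f) =
      κ g • mono (h * g) (P * symMap φ (qDeriv q x c F)) := by
  simp [twistedQDeriv, liftMono_mono]

theorem twistedQDeriv_mono_eq_zero_iff {h : G} {κ : G → k} {P : SymmetricAlgebra k V}
    {φ ψ : V →ₗ[k] V} {q : k} {x : V} {c : V →ₗ[k] k} {g : G} (hκ : κ g ≠ 0) (hP : P ≠ 0)
    (hφ : ψ * φ = 1) (F : SymmetricAlgebra k V) :
    twistedQDeriv h κ P φ q x c (mono g F : CrossedProduct ρ f) = 0 ↔ qDeriv q x c F = 0 := by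
  rw [twistedQDeriv_mono, smul_eq_zero_iff_right hκ, mono_eq_zero_iff, mul_eq_zero,
    or_iff_right hP, map_eq_zero_iff _ (symMap_injective hφ)]

theorem twistedQDeriv_pow_eq_zero (h : G) (κ : G → k) {P : SymmetricAlgebra k V}
    {φ : V →ₗ[k] V} {q : k} {x : V} {c : V →ₗ[k] k} (hx : c x = 1)
    (hφ : ∀ v ∈ LinearMap.ker c, φ v ∈ LinearMap.ker c) {a : k} (ha : φ x = a • x)
    (hP : qDeriv q x c P = 0) {l : ℕ} (hl : 0 < l) (hq : q ≠ 1) (hql : q ^ l = 1) :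
    (twistedQDeriv h κ P φ q x c : Module.End k (CrossedProduct ρ f)) ^ l = 0 := by
  -- Each application replaces `w_g` by `w_{hg}` and `F` by `P φ(∂F)`, so the induction ranges over
  -- all `g` and `F`. The next hypothesis holds because `∂ⁿ(P φ(∂F)) = aⁿ P φ(∂ⁿ⁺¹F)`.
  have key : ∀ n g F, (qDeriv q x c ^ n) F = 0 →
      ((twistedQDeriv h κ P φ q x c : Module.End k (CrossedProduct ρ f)) ^ n) (mono g F) = 0 := by
    intro n
    induction n with
    | zero => intro g F hF; simpa using congrArg (mono g) hF
    | succ n ih =>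
      intro g F hF
      rw [pow_succ, Module.End.mul_apply, twistedQDeriv_mono, map_smul, ih, smul_zero]
      rw [qDeriv_pow_mul_symMap ha (dual_apply_eq_mul hx hφ ha) hP, ← Module.End.mul_apply,
        ← pow_succ, hF]
      simp
  refine LinearMap.ext fun b => ?_
  induction b using induction_mono with
  | h0 => simp
  | hadd a b ha hb => rw [map_add, ha, hb]; simp
  | hm g F => exact key l g F (by rw [qDeriv_pow_eq_zero hq hl hql hx]; rfl)

theorem mono_one_mul_smul_mono_mul_mono (h g : G) (r : k) (A P B : SymmetricAlgebra k V) :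
    (mono 1 A * (r • mono h P) * mono g B : CrossedProduct ρ f) =
      ((f.toFun h g : kˣ) : k) • mono (h * g) (P * (A * algebraMap k _ r * symMap (ρ h) B)) := by
  rw [← map_smul, mono_mul_mono, mono_mul_mono, f.one_left, map_one, symMap_one, one_mul, ← map_smul]
  simp only [Units.val_one, AlgHom.id_apply, Algebra.smul_def, map_one]
  congr 2
  ring

/-- `F ↦ α(∂F)` satisfies a Leibniz rule with `α` on the left and `α σ = h ς` on the right. Moving
`w_h` past `ς(v_{j+1} ⋯ v_m)` produces exactly this `h`, and the scalars `f(h,g) χ_ς(g)` collect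
what remains. -/
theorem isDelta₁_twistedQDeriv {α : V ≃ₗ[k] V} {χα χς : G →* kˣ} {ς : V →ₗ[k] V}
    {δhat : V →ₗ[k] CrossedProduct ρ f} {h : G} {P : SymmetricAlgebra k V} {q : k} {x : V}
    {c : V →ₗ[k] k} (hδ : ∀ v, δhat v = c v • mono h P)
    (hς : ρ h * ς = α.toLinearMap * scaleAlong q x c) :
    IsDelta₁ (diagEquiv α χα) (diag ς χς) δhat
      (twistedQDeriv h (fun g => ((f.toFun h g : kˣ) : k) * ((χς g : kˣ) : k)) P
        α.toLinearMap q x c) := by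
  intro m v g
  have hα : ∀ F, diagEquiv α χα (mono 1 F : CrossedProduct ρ f) = mono 1 (symMap α.toLinearMap F) :=
    fun F => (diag_mono _ _ _ _).trans (by simp)
  have hp := map_prod_of_skew_leibniz
    ((symMap α.toLinearMap).toLinearMap ∘ₗ qDeriv q x c).toAddMonoidHom
    (symMap α.toLinearMap).toRingHom.toMonoidHom (symMap (ρ h * ς)).toRingHom.toMonoidHom
    (fun F H => by simp [qDeriv_mul, hς, ← symMap_symMap]) m
    (fun i => SymmetricAlgebra.ι k V (v i))
  simp only [LinearMap.toAddMonoidHom_coe, LinearMap.comp_apply, AlgHom.toLinearMap_apply,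
    RingHom.toMonoidHom_eq_coe, MonoidHom.coe_coe, AlgHom.toRingHom_eq_coe, RingHom.coe_coe,
    qDeriv_ι, AlgHom.commutes] at hp
  rw [twistedQDeriv_mono, hp, Finset.mul_sum, map_sum, Finset.smul_sum]
  refine Finset.sum_congr rfl fun j _ => ?_
  rw [hα, hδ, diag_mono, mul_smul_comm, mono_one_mul_smul_mono_mul_mono, symMap_symMap, smul_smul,
    mul_comm]

theorem isDelta₂_twistedQDeriv {α : V ≃ₗ[k] V} {χα χς : G →* kˣ} {ς : V →ₗ[k] V}
    {δhat : V →ₗ[k] CrossedProduct ρ f} {h : G} {P : SymmetricAlgebra k V} {q : k} {x : V}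
    {c : V →ₗ[k] k} (hδ : ∀ v, δhat v = c v • mono h P)
    (hς : ς * α.symm.toLinearMap = ρ h * scaleAlong q x c) :
    IsDelta₂ (diagEquiv α χα) (diag ς χς) δhat
      (twistedQDeriv h (fun g => ((f.toFun h g : kˣ) : k)) P (ρ h) q x c) := by
  intro m v g
  have hα : ∀ F, diag ς χς ((diagEquiv α χα).symm (mono 1 F : CrossedProduct ρ f)) =
      mono 1 (symMap (ς * α.symm.toLinearMap) F) := fun F => by
    have : (diagEquiv α χα).symm (mono 1 F : CrossedProduct ρ f) =
      mono 1 (symMap α.symm.toLinearMap F) := (diag_mono _ _ _ _).trans (by simp)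
    rw [this, diag_mono, symMap_symMap]
    simp
  have hp := map_prod_of_skew_leibniz
    ((symMap (ρ h)).toLinearMap ∘ₗ qDeriv q x c).toAddMonoidHom
    (symMap (ς * α.symm.toLinearMap)).toRingHom.toMonoidHom (symMap (ρ h)).toRingHom.toMonoidHom
    (fun F H => by
      -- Commutativity of `S(V)` moves the scaling to the left factor, where `ς α⁻¹ = h σ` is
      -- needed.
      rw [mul_comm F H]
      simp [qDeriv_mul, hς, ← symMap_symMap]
      ring) m
    (fun i => SymmetricAlgebra.ι k V (v i))
  simp only [LinearMap.toAddMonoidHom_coe, LinearMap.comp_apply, AlgHom.toLinearMap_apply,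
    RingHom.toMonoidHom_eq_coe, MonoidHom.coe_coe, AlgHom.toRingHom_eq_coe, RingHom.coe_coe,
    qDeriv_ι, AlgHom.commutes] at hp
  rw [twistedQDeriv_mono, hp, Finset.mul_sum, map_sum, Finset.smul_sum]
  refine Finset.sum_congr rfl fun j _ => ?_
  rw [hα, hδ, mono_one_mul_smul_mono_mul_mono]

end CrossedProduct

end BraidedDeformation

end

/-! ### The theorem for the given data. -/

theorem mainTheorem9
    {k G V : Type*} [Field k] [Group G] [AddCommGroup V] [Module k V] [FiniteDimensional k V]
    (ρ : Representation k G V) (f : BraidedDeformation.NormalCocycle G k)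
    (q : k) (hq : q ≠ 0)
    -- the automorphism `α` of `A = S(V) #_f G`
    (αhat : V ≃ₗ[k] V) (hαhat : ∀ g v, αhat (ρ g v) = ρ g (αhat v)) (χα : G →* kˣ)
    -- a)
    (V₁ V₂ : Submodule k V) (hV : V₁ ≠ V₂)
    (hcodim₁ : Module.finrank k (V ⧸ V₁) = 1) (hcodim₂ : Module.finrank k (V ⧸ V₂) = 1)
    (hG₁ : ∀ g, ∀ v ∈ V₁, ρ g v ∈ V₁) (hG₂ : ∀ g, ∀ v ∈ V₂, ρ g v ∈ V₂)
    (hα₁ : ∀ v ∈ V₁, αhat v ∈ V₁) (hα₂ : ∀ v ∈ V₂, αhat v ∈ V₂)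
    -- b)
    (g₁ g₂ : G) (hg₁ : g₁ ∈ Subgroup.center G) (hg₂ : g₂ ∈ Subgroup.center G)
    (hg : ∀ v ∈ V₁ ⊓ V₂, ρ g₁⁻¹ v = ρ g₂ v)
    -- c)
    (χς : G →* kˣ) (ςhat : V →ₗ[k] V)
    (hς₁ : ∀ v ∈ V₁, ςhat v = αhat (ρ g₁⁻¹ v)) (hς₂ : ∀ v ∈ V₂, ςhat v = αhat (ρ g₂ v))
    -- d)
    (x₁ x₂ : V) (hx₁ : x₁ ∈ V₂ ∧ x₁ ∉ V₁) (hx₂ : x₂ ∈ V₁ ∧ x₂ ∉ V₂)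
    (P₁ P₂ : SymmetricAlgebra k V)
    (hP₁ : P₁ ∈ BraidedDeformation.symSub V₁) (hP₂ : P₂ ∈ BraidedDeformation.symSub V₂)
    (δhat₁ δhat₂ : V →ₗ[k] BraidedDeformation.CrossedProduct ρ f)
    (hker₁ : LinearMap.ker δhat₁ = V₁) (hker₂ : LinearMap.ker δhat₂ = V₂)
    (hδx₁ : δhat₁ x₁ = BraidedDeformation.CrossedProduct.mono g₁ P₁)
    (hδx₂ : δhat₂ x₂ = BraidedDeformation.CrossedProduct.mono g₂ P₂)
    -- the scalars `λ_{1g}` and `λ_{2g}`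
    (lam₁ lam₂ : G → k)
    (hlam₁ : ∀ g, ρ g x₁ - lam₁ g • x₁ ∈ V₁) (hlam₂ : ∀ g, ρ g x₂ - lam₂ g • x₂ ∈ V₂)
    (hq₁ : lam₁ g₁ * lam₁ g₂ = q) (hq₂ : lam₂ g₁ * lam₂ g₂ = q⁻¹)
    (h₁₁ : ρ g₁ x₁ = lam₁ g₁ • x₁) (h₁₂ : ρ g₁ x₂ = lam₂ g₁ • x₂)
    (h₂₁ : ρ g₂ x₁ = lam₁ g₂ • x₁) (h₂₂ : ρ g₂ x₂ = lam₂ g₂ • x₂) :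
    -- `δ₁` and `δ₂` are well defined
    (∃! δ₁, BraidedDeformation.CrossedProduct.IsDelta₁
      (BraidedDeformation.CrossedProduct.diagEquiv αhat χα)
      (BraidedDeformation.CrossedProduct.diag ςhat χς) δhat₁ δ₁) ∧
    (∃! δ₂, BraidedDeformation.CrossedProduct.IsDelta₂
      (BraidedDeformation.CrossedProduct.diagEquiv αhat χα)
      (BraidedDeformation.CrossedProduct.diag ςhat χς) δhat₂ δ₂) ∧
    ∀ δ₁ δ₂ : Module.End k (BraidedDeformation.CrossedProduct ρ f),
      BraidedDeformation.CrossedProduct.IsDelta₁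
        (BraidedDeformation.CrossedProduct.diagEquiv αhat χα)
        (BraidedDeformation.CrossedProduct.diag ςhat χς) δhat₁ δ₁ →
      BraidedDeformation.CrossedProduct.IsDelta₂
        (BraidedDeformation.CrossedProduct.diagEquiv αhat χα)
        (BraidedDeformation.CrossedProduct.diag ςhat χς) δhat₂ δ₂ →
      -- (1)
      (∀ l : ℕ, 0 < l → q ≠ 1 → q ^ l = 1 → δ₁ ^ l = 0 ∧ δ₂ ^ l = 0) ∧
      -- (2)
      (((q = 1 ∧ CharZero k) ∨ (∀ l : ℕ, 0 < l → q ^ l ≠ 1)) →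
        ((δ₂ (BraidedDeformation.CrossedProduct.mono 1 P₁) = 0 ∧
            δ₁ (BraidedDeformation.CrossedProduct.mono 1 P₂) = 0) ↔
          (P₁ ∈ BraidedDeformation.symSub (V₁ ⊓ V₂) ∧
            P₂ ∈ BraidedDeformation.symSub (V₁ ⊓ V₂)))) ∧
      -- (3)
      (∀ l : ℕ, 2 ≤ l → IsPrimitiveRoot q l →
        ((δ₂ (BraidedDeformation.CrossedProduct.mono 1 P₁) = 0 ∧
            δ₁ (BraidedDeformation.CrossedProduct.mono 1 P₂) = 0) ↔
          (P₁ ∈ BraidedDeformation.symSubPow x₂ l (V₁ ⊓ V₂) ∧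
            P₂ ∈ BraidedDeformation.symSubPow x₁ l (V₁ ⊓ V₂)))) ∧
      -- (4)
      (∀ p : ℕ, 0 < p → CharP k p → q = 1 →
        ((δ₂ (BraidedDeformation.CrossedProduct.mono 1 P₁) = 0 ∧
            δ₁ (BraidedDeformation.CrossedProduct.mono 1 P₂) = 0) ↔
          (P₁ ∈ BraidedDeformation.symSubPow x₂ p (V₁ ⊓ V₂) ∧
            P₂ ∈ BraidedDeformation.symSubPow x₁ p (V₁ ⊓ V₂)))) := by
  obtain ⟨c₁, hc₁, rfl⟩ :=
    BraidedDeformation.exists_dual_eq_one_of_finrank_quotient hcodim₁ hx₁.2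
  obtain ⟨c₂, hc₂, rfl⟩ :=
    BraidedDeformation.exists_dual_eq_one_of_finrank_quotient hcodim₂ hx₂.2
  have hd₁ := BraidedDeformation.sub_dual_smul_mem_ker hc₁
  have hd₂ := BraidedDeformation.sub_dual_smul_mem_ker hc₂
  have hδ₁ : ∀ v, δhat₁ v = c₁ v • BraidedDeformation.CrossedProduct.mono g₁ P₁ := fun v => by
    have h : v - c₁ v • x₁ ∈ LinearMap.ker δhat₁ := hker₁ ▸ hd₁ v
    rw [LinearMap.mem_ker, map_sub, map_smul, sub_eq_zero] at h
    rw [h, hδx₁]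
  have hδ₂ : ∀ v, δhat₂ v = c₂ v • BraidedDeformation.CrossedProduct.mono g₂ P₂ := fun v => by
    have h : v - c₂ v • x₂ ∈ LinearMap.ker δhat₂ := hker₂ ▸ hd₂ v
    rw [LinearMap.mem_ker, map_sub, map_smul, sub_eq_zero] at h
    rw [h, hδx₂]
  have hP₁0 : P₁ ≠ 0 := by
    rintro rfl
    exact hx₁.2 (hker₁ ▸ LinearMap.mem_ker.mpr (by rw [hδx₁, map_zero]))
  have hP₂0 : P₂ ≠ 0 := by
    rintro rfl
    exact hx₂.2 (hker₂ ▸ LinearMap.mem_ker.mpr (by rw [hδx₂, map_zero]))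
  have hinv : ∀ g v, ρ g (ρ g⁻¹ v) = v := fun g v => by simp
  have hinv' : ∀ g v, ρ g⁻¹ (ρ g v) = v := fun g v => by simp
  -- Finite dimension turns `α(U) ⊆ U` into an equality.
  have hαs : ∀ U : Submodule k V, (∀ v ∈ U, αhat v ∈ U) → ∀ v ∈ U, αhat.symm v ∈ U := by
    intro U hU v hv
    have hle : U.map αhat.toLinearMap ≤ U := by
      rintro _ ⟨u, hu, rfl⟩
      exact hU u hu
    have heq := Submodule.eq_of_le_of_finrank_eq hle (LinearEquiv.finrank_map_eq αhat U)
    rw [← heq] at hv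
    obtain ⟨u, hu, rfl⟩ := hv
    simpa using hu
  have hαsg : ∀ g v, αhat (ρ g (αhat.symm v)) = ρ g v := fun g v => by
    rw [hαhat, LinearEquiv.apply_symm_apply]
  have hςα₁ : ρ g₁ * ςhat = αhat.toLinearMap * BraidedDeformation.scaleAlong q x₁ c₁ := by
    refine LinearMap.ext fun v => ?_
    have hv : v = (v - c₁ v • x₁) + c₁ v • x₁ := by abel
    have h1 : ρ g₁ (ςhat (v - c₁ v • x₁)) = αhat (v - c₁ v • x₁) := by
      rw [hς₁ _ (hd₁ v), hαhat, hinv]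
    -- Since `x₁ ∈ V₂`, `ς` acts on it through `g₂`, and `λ_{1g₁} λ_{1g₂} = q`.
    have h2 : ρ g₁ (ςhat x₁) = q • αhat x₁ := by
      rw [hς₂ _ hx₁.1, ← hαhat, h₂₁, map_smul, h₁₁, smul_smul, map_smul, mul_comm, hq₁]
    have h3 : ρ g₁ (ςhat v) = αhat (v - c₁ v • x₁) + c₁ v • q • αhat x₁ := by
      rw [← h1, ← h2, ← map_smul, ← map_smul, ← map_add, ← map_add, ← hv]
    rw [Module.End.mul_apply, h3, Module.End.mul_apply, BraidedDeformation.scaleAlong_apply]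
    simp only [map_sub, map_add, map_smul, LinearEquiv.coe_coe]
    module
  have hςα₂ : ςhat * αhat.symm.toLinearMap = ρ g₂ * BraidedDeformation.scaleAlong q x₂ c₂ := by
    refine LinearMap.ext fun v => ?_
    have hv : v = (v - c₂ v • x₂) + c₂ v • x₂ := by abel
    have h1 : ςhat (αhat.symm (v - c₂ v • x₂)) = ρ g₂ (v - c₂ v • x₂) := by
      rw [hς₂ _ (hαs _ hα₂ _ (hd₂ v)), hαsg]
    -- Since `α⁻¹x₂ ∈ V₁`, the left side is `g₁⁻¹x₂`; it equals `q λ_{2g₂} x₂` because `λ_{2g₁}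
    -- λ_{2g₂} = q⁻¹`.
    have h2 : ςhat (αhat.symm x₂) = q • ρ g₂ x₂ := by
      rw [hς₁ _ (hαs _ hα₁ _ hx₂.1), hαsg, h₂₂, smul_smul]
      have h : ρ g₁ ((q * lam₂ g₂) • x₂) = x₂ := by
        rw [map_smul, h₁₂, smul_smul, mul_assoc, mul_comm (lam₂ g₂), hq₂, mul_inv_cancel₀ hq,
          one_smul]
      conv_lhs => rw [← h, hinv']
    have h3 : ςhat (αhat.symm v) = ρ g₂ (v - c₂ v • x₂) + c₂ v • q • ρ g₂ x₂ := by
      rw [← h1, ← h2, ← map_smul, ← map_smul, ← map_add, ← map_add, ← hv]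
    rw [Module.End.mul_apply, LinearEquiv.coe_coe, h3, Module.End.mul_apply,
      BraidedDeformation.scaleAlong_apply]
    simp only [map_sub, map_add, map_smul]
    module
  have hD₁ := BraidedDeformation.CrossedProduct.isDelta₁_twistedQDeriv (χα := χα) (χς := χς)
    hδ₁ hςα₁
  have hD₂ := BraidedDeformation.CrossedProduct.isDelta₂_twistedQDeriv (χα := χα) (χς := χς)
    hδ₂ hςα₂
  have hU₁ := fun δ (h : BraidedDeformation.CrossedProduct.IsDelta₁ _ _ δhat₁ δ) =>
    BraidedDeformation.CrossedProduct.end_ext_prod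
      fun m v g => (h m v g).trans (hD₁ m v g).symm
  have hU₂ := fun δ (h : BraidedDeformation.CrossedProduct.IsDelta₂ _ _ δhat₂ δ) =>
    BraidedDeformation.CrossedProduct.end_ext_prod
      fun m v g => (h m v g).trans (hD₂ m v g).symm
  refine ⟨⟨_, hD₁, hU₁⟩, ⟨_, hD₂, hU₂⟩, ?_⟩
  intro δ₁ δ₂ hδδ₁ hδδ₂
  rw [hU₁ _ hδδ₁, hU₂ _ hδδ₂,
    BraidedDeformation.CrossedProduct.twistedQDeriv_mono_eq_zero_iff (ψ := ρ g₂⁻¹)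
      (κ := fun g => ((f.toFun g₂ g : kˣ) : k))
      (Units.ne_zero _) hP₂0 (LinearMap.ext (hinv' g₂)),
    BraidedDeformation.CrossedProduct.twistedQDeriv_mono_eq_zero_iff (ψ := αhat.symm.toLinearMap)
      (κ := fun g => ((f.toFun g₁ g : kˣ) : k) * ((χς g : kˣ) : k))
      (mul_ne_zero (Units.ne_zero _) (Units.ne_zero _)) hP₁0
      (LinearMap.ext αhat.symm_apply_apply)]
  -- `V₁ = k x₂ ⊕ (V₁ ∩ V₂)`, so elements of `S(V₁)` expand in `x₂` with coefficients in `S(V₁ ∩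
  -- V₂)`.
  have hUW₁ : ∀ u ∈ LinearMap.ker c₁, u - c₂ u • x₂ ∈ LinearMap.ker c₁ ⊓ LinearMap.ker c₂ :=
    fun u hu => ⟨sub_mem hu (Submodule.smul_mem _ _ hx₂.1), hd₂ u⟩
  have hUW₂ : ∀ u ∈ LinearMap.ker c₂, u - c₁ u • x₁ ∈ LinearMap.ker c₁ ⊓ LinearMap.ker c₂ :=
    fun u hu => ⟨hd₁ u, sub_mem hu (Submodule.smul_mem _ _ hx₁.1)⟩
  refine ⟨fun l hl hq1 hql => ⟨?_, ?_⟩, fun hq' => ?_, fun l hl hprim => ?_, fun p hp hchar hq1 => ?_⟩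
  · -- `αhat x₁ - c₁ (αhat x₁) x₁` is both fixed by `g₁ g₂` and multiplied by `q`
    have hw := hd₁ (αhat x₁)
    have hw₂ : αhat x₁ - c₁ (αhat x₁) • x₁ ∈ LinearMap.ker c₂ :=
      sub_mem (hα₂ _ hx₁.1) (Submodule.smul_mem _ _ hx₁.1)
    have h1 := hinv g₁ (αhat x₁ - c₁ (αhat x₁) • x₁)
    rw [hg _ ⟨hw, hw₂⟩] at h1
    have h2 : ρ g₁ (ρ g₂ (αhat x₁ - c₁ (αhat x₁) • x₁)) =
        q • (αhat x₁ - c₁ (αhat x₁) • x₁) := by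
      simp only [map_sub, map_smul, ← hαhat, h₂₁, h₁₁, smul_smul, smul_sub, ← hq₁]
      module
    have h3 : (q - 1) • (αhat x₁ - c₁ (αhat x₁) • x₁) = 0 := by
      rw [sub_smul, ← h2, h1, one_smul, sub_self]
    exact BraidedDeformation.CrossedProduct.twistedQDeriv_pow_eq_zero _ _ hc₁ hα₁
      (sub_eq_zero.mp ((smul_eq_zero.mp h3).resolve_left (sub_ne_zero.mpr hq1)))
      (BraidedDeformation.symSub_le_qConstants q x₁ c₁ le_rfl hP₁).1 hl hq1 hql
  · exact BraidedDeformation.CrossedProduct.twistedQDeriv_pow_eq_zero _ _ hc₂ (hG₂ g₂) h₂₂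
      (BraidedDeformation.symSub_le_qConstants q x₂ c₂ le_rfl hP₂).1 hl hq1 hql
  · have hn : ∀ n, 0 < n → ∑ i ∈ Finset.range n, q ^ i ≠ 0 := by
      rintro n hn h0
      rcases hq' with ⟨rfl, _⟩ | hq'
      · simp only [one_pow, Finset.sum_const, Finset.card_range, nsmul_eq_mul, mul_one,
          Nat.cast_eq_zero] at h0
        omega
      · exact hq' n hn (BraidedDeformation.pow_eq_one_of_geom_sum_eq_zero h0)
    exact and_congr
      (BraidedDeformation.qDeriv_eq_zero_iff_mem_symSub hc₂ hn hUW₁ inf_le_right hP₁)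
      (BraidedDeformation.qDeriv_eq_zero_iff_mem_symSub hc₁ hn hUW₂ inf_le_left hP₂)
  · have hn : ∀ n, ∑ i ∈ Finset.range n, q ^ i = 0 ↔ l ∣ n := fun n => by
      rw [← hprim.pow_eq_one_iff_dvd]
      exact ⟨BraidedDeformation.pow_eq_one_of_geom_sum_eq_zero,
        BraidedDeformation.geom_sum_eq_zero_of_pow_eq_one (hprim.ne_one (by omega))⟩
    exact and_congr
      (BraidedDeformation.qDeriv_eq_zero_iff_mem_symSubPow hc₂ hn hUW₁ inf_le_right hP₁)
      (BraidedDeformation.qDeriv_eq_zero_iff_mem_symSubPow hc₁ hn hUW₂ inf_le_left hP₂)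
  -- For `q = 1` the `q`-integer `[n]` is the image of `n` in `k`, so `p` plays the role of `l`.
  · have hn : ∀ n, ∑ i ∈ Finset.range n, q ^ i = 0 ↔ p ∣ n := fun n => by
      simp [hq1, CharP.cast_eq_zero_iff k p n]
    exact and_congr
      (BraidedDeformation.qDeriv_eq_zero_iff_mem_symSubPow hc₂ hn hUW₁ inf_le_right hP₁)
      (BraidedDeformation.qDeriv_eq_zero_iff_mem_symSubPow hc₁ hn hUW₂ inf_le_left hP₂)
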